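/- Let $n\ge 2$ be an integer and let $q\in(1,\infty)$. There is a finite constant $N=N(n,q)$, depending only on $n$ and $q$, such that for every bounded domain (nonempty, connected, open, bounded set) $V\subset\mathbb{R}^n$ and every $\phi\in\mathrm{BMO}(V)$, $$[\phi]_{\mathrm{BMO}(V)}\;\le\;\sup_{Q\Subset V}\left(\frac1{|Q|}\int_Q|\phi(x)-\langle\phi\rangle_Q|^q\,dx\right)^{1/q}\;\le\;N\,[\phi]_{\mathrm{BMO}(V)}.$$ Here $Q$ ranges over the nonempty, bounded, open cubes with faces parallel to the coordinate hyperplanes for which there is a compact set $K$ with $Q\subset K\subset V$ (written $Q\Subset V$), $|Q|$ is the Lebesgue measure of $Q$, and $\langle\phi\rangle_Q=\frac1{|Q|}\int_Q\phi(x)\,dx$. For a real-valued $\phi\in L^1_{\mathrm{loc}}(V)$, $$[\phi]_{\mathrm{BMO}(V)}=\sup_{Q\Subset V}\frac1{|Q|}\int_Q|\phi(x)-\langle\phi\rangle_Q|\,dx,$$ and $\mathrm{BMO}(V)$ is the set of $\phi\in L^1_{\mathrm{loc}}(V)$ with $[\phi]_{\mathrm{BMO}(V)}<\infty$. -/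

import Mathlib

open MeasureTheory
open scoped ENNReal NNReal

noncomputable section

namespace BMOSpace

/-- A bounded domain in `ℝⁿ`: a bounded, nonempty, connected, open set. -/
structure IsBoundedDomain {n : ℕ} (V : Set (EuclideanSpace ℝ (Fin n))) : Prop where
  isOpen : IsOpen V
  isConnected : IsConnected V
  isBounded : Bornology.IsBounded V

/-- The open cube with faces parallel to the coordinate hyperplanes, lowest corner `a`
and side length `ℓ`. -/
def openCube {n : ℕ} (a : EuclideanSpace ℝ (Fin n)) (ℓ : ℝ) : Set (EuclideanSpace ℝ (Fin n)) :=
  {x | ∀ i, a i < x i ∧ x i < a i + ℓ}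

/-- `Q` is a nonempty, bounded, open cube with faces parallel to the coordinate hyperplanes. -/
def IsCube {n : ℕ} (Q : Set (EuclideanSpace ℝ (Fin n))) : Prop :=
  ∃ (a : EuclideanSpace ℝ (Fin n)) (ℓ : ℝ), 0 < ℓ ∧ Q = openCube a ℓ

/-- `U ⋐ V`: there is a compact set between `U` and `V`. -/
def CompactlyContained {n : ℕ} (U V : Set (EuclideanSpace ℝ (Fin n))) : Prop :=
  ∃ K : Set (EuclideanSpace ℝ (Fin n)), IsCompact K ∧ U ⊆ K ∧ K ⊆ V

/-- The seminorm `sup_{Q ⋐ V} ⨍_Q |φ - ⟨φ⟩_Q|`, with values in `[0, ∞]`. -/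
def bmoSeminorm {n : ℕ} (V : Set (EuclideanSpace ℝ (Fin n)))
    (φ : EuclideanSpace ℝ (Fin n) → ℝ) : ℝ≥0∞ :=
  ⨆ (Q : Set (EuclideanSpace ℝ (Fin n))) (_ : IsCube Q ∧ CompactlyContained Q V),
    ⨍⁻ x in Q, ‖φ x - ⨍ y in Q, φ y‖ₑ ∂volume

/-- The seminorm `sup_{Q ⋐ V} (⨍_Q |φ - ⟨φ⟩_Q|^q)^(1/q)`, with values in `[0, ∞]`. -/
def bmoSeminormLq {n : ℕ} (q : ℝ) (V : Set (EuclideanSpace ℝ (Fin n)))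
    (φ : EuclideanSpace ℝ (Fin n) → ℝ) : ℝ≥0∞ :=
  ⨆ (Q : Set (EuclideanSpace ℝ (Fin n))) (_ : IsCube Q ∧ CompactlyContained Q V),
    (⨍⁻ x in Q, ‖φ x - ⨍ y in Q, φ y‖ₑ ^ q ∂volume) ^ (1 / q)

/-- `φ ∈ BMO(V)`: `φ` is locally integrable on `V` and its seminorm is finite.
Only the values of `φ` on `V` matter. -/
def MemBMO {n : ℕ} (V : Set (EuclideanSpace ℝ (Fin n)))
    (φ : EuclideanSpace ℝ (Fin n) → ℝ) : Prop :=
  LocallyIntegrableOn φ V ∧ bmoSeminorm V φ < ∞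

end BMOSpace

end

/-! The lower bound is monotonicity of `L^p` norms on a probability space. The upper bound is
John–Nirenberg. Let `B` bound the mean oscillations, and let `m` be the mean of `f` on a cube `Q`.
Bisect `Q`, stopping at subcubes where the mean of `|f - m|` exceeds `2B`. Their total volume is at
most `|Q|/2`. Each has an unstopped parent, so its own mean is within `λ = 2^n * 2B` of `m`. Off
them `|f - m| ≤ 2B` a.e. by Lebesgue differentiation.

Thus `{|f - m| > (k+1)λ}` lies a.e. in the stopped cubes, where `f` deviates from the local mean by
more than `kλ`. Induction on `k` gives the decay `2⁻ᵏ` (`volume_oscillation_gt_le`), and summing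
over levels gives the `L^q` bound (`lintegral_rpow_le_of_measure_gt_le`). Only finitely many
generations are run at a time (`exists_stopping_set`), so no infinite family of maximal cubes is
needed. -/

noncomputable section

namespace BMOSpace

open Set Filter Topology

variable {n : ℕ}

/-! ### Dyadic subdivision of half-open cubes -/

/-- The half-open cube with lowest corner `a` and side length `ℓ`. -/
def box (a : Fin n → ℝ) (ℓ : ℝ) : Set (Fin n → ℝ) :=
  univ.pi fun i => Ico (a i) (a i + ℓ)

/-- The lowest corner of the dyadic child of `box a ℓ` selected by `b`. -/
def childCorner (a : Fin n → ℝ) (ℓ : ℝ) (b : Fin n → Bool) : Fin n → ℝ :=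
  fun i => a i + if b i then ℓ / 2 else 0

/-- The cube with corner `a'` and side `ℓ'` lies inside the one with corner `a` and side `ℓ`. -/
def SubBox (a' : Fin n → ℝ) (ℓ' : ℝ) (a : Fin n → ℝ) (ℓ : ℝ) : Prop :=
  ∀ i, a i ≤ a' i ∧ a' i + ℓ' ≤ a i + ℓ

theorem SubBox.refl (a : Fin n → ℝ) (ℓ : ℝ) : SubBox a ℓ a ℓ := fun _ => ⟨le_rfl, le_rfl⟩

theorem SubBox.trans {a b c : Fin n → ℝ} {r s t : ℝ} (h : SubBox a r b s) (h' : SubBox b s c t) :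
    SubBox a r c t :=
  fun i => ⟨(h' i).1.trans (h i).1, (h i).2.trans (h' i).2⟩

theorem SubBox.subset {a b : Fin n → ℝ} {r s : ℝ} (h : SubBox a r b s) : box a r ⊆ box b s :=
  pi_mono fun i _ => Ico_subset_Ico (h i).1 (h i).2

theorem subBox_childCorner (a : Fin n → ℝ) {ℓ : ℝ} (hℓ : 0 < ℓ) (b : Fin n → Bool) :
    SubBox (childCorner a ℓ b) (ℓ / 2) a ℓ := by
  intro i
  unfold childCorner
  split_ifs <;> constructor <;> linarith

theorem measurableSet_box (a : Fin n → ℝ) (ℓ : ℝ) : MeasurableSet (box a ℓ) :=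
  MeasurableSet.univ_pi fun _ => measurableSet_Ico

theorem volume_box (a : Fin n → ℝ) (ℓ : ℝ) : volume (box a ℓ) = ENNReal.ofReal ℓ ^ n := by
  simp [box, Real.volume_pi_Ico]

theorem volume_box_ne_top (a : Fin n → ℝ) (ℓ : ℝ) : volume (box a ℓ) ≠ ∞ := by
  rw [volume_box]; exact ENNReal.pow_ne_top ENNReal.ofReal_ne_top

theorem volume_box_ne_zero (a : Fin n → ℝ) {ℓ : ℝ} (hℓ : 0 < ℓ) : volume (box a ℓ) ≠ 0 := by
  rw [volume_box]; exact pow_ne_zero _ (by simpa using hℓ)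

theorem volume_box_eq_mul_child (a a' : Fin n → ℝ) (ℓ : ℝ) :
    volume (box a ℓ) = 2 ^ n * volume (box a' (ℓ / 2)) := by
  rw [volume_box, volume_box, ← mul_pow]
  congr 1
  rw [← ENNReal.ofReal_ofNat 2, ← ENNReal.ofReal_mul (by norm_num)]
  congr 1; ring

/-- Half-open sides make the children an exact partition, so no null sets enter the bisection. -/
theorem iUnion_child (a : Fin n → ℝ) {ℓ : ℝ} (hℓ : 0 < ℓ) :
    ⋃ b, box (childCorner a ℓ b) (ℓ / 2) = box a ℓ := by
  apply Subset.antisymm (iUnion_subset fun b => (subBox_childCorner a hℓ b).subset)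
  intro x hx
  refine mem_iUnion.2 ⟨fun i => decide (a i + ℓ / 2 ≤ x i), fun i hi => ?_⟩
  have := hx i hi
  simp only [mem_Ico, childCorner, decide_eq_true_eq] at this ⊢
  split_ifs with h <;> constructor <;> linarith

theorem pairwise_disjoint_child (a : Fin n → ℝ) (ℓ : ℝ) :
    Pairwise (Function.onFun Disjoint fun b => box (childCorner a ℓ b) (ℓ / 2)) := by
  intro b c hbc
  obtain ⟨i, hi⟩ := Function.ne_iff.1 hbc
  refine Set.disjoint_left.2 fun x hx hx' => ?_
  have h1 := hx i (mem_univ i)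
  have h2 := hx' i (mem_univ i)
  simp only [mem_Ico, childCorner] at h1 h2
  cases hb : b i <;> cases hc : c i <;> simp_all <;> linarith

theorem sum_lintegral_child (g : (Fin n → ℝ) → ℝ≥0∞) (a : Fin n → ℝ) {ℓ : ℝ} (hℓ : 0 < ℓ) :
    ∑ b, ∫⁻ x in box (childCorner a ℓ b) (ℓ / 2), g x = ∫⁻ x in box a ℓ, g x := by
  rw [← iUnion_child a hℓ, lintegral_iUnion (fun b => measurableSet_box _ _)
    (pairwise_disjoint_child a ℓ), tsum_fintype]

theorem box_ae_eq_closedBall (a : Fin n → ℝ) {ℓ : ℝ} (hℓ : 0 < ℓ) :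
    box a ℓ =ᵐ[volume] Metric.closedBall (fun i => a i + ℓ / 2) (ℓ / 2) := by
  have h : Metric.closedBall (fun i => a i + ℓ / 2) (ℓ / 2) = Icc a (fun i => a i + ℓ) := by
    rw [closedBall_pi _ (by positivity), ← pi_univ_Icc]
    congr 1; ext1 i
    rw [Real.closedBall_eq_Icc]; congr 1 <;> ring
  rw [h]
  exact Measure.univ_pi_Ico_ae_eq_Icc

/-! ### Stopping cubes and Lebesgue differentiation -/

/-- The stopping-time argument of Calderón and Zygmund, run for `k` generations. -/
theorem exists_stopping_set {g : (Fin n → ℝ) → ℝ≥0∞} {E : Set (Fin n → ℝ)} {t M : ℝ≥0∞}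
    {a₀ : Fin n → ℝ} {ℓ₀ : ℝ}
    (hE : ∀ a ℓ, 0 < ℓ → SubBox a ℓ a₀ ℓ₀ → t * volume (box a ℓ) < ∫⁻ x in box a ℓ, g x →
      ∫⁻ x in box a ℓ, g x ≤ 2 ^ n * t * volume (box a ℓ) →
      t * volume (E ∩ box a ℓ) ≤ M * ∫⁻ x in box a ℓ, g x) (k : ℕ) :
    ∀ a ℓ, 0 < ℓ → SubBox a ℓ a₀ ℓ₀ → ∫⁻ x in box a ℓ, g x ≤ t * volume (box a ℓ) →
      ∃ S, t * volume (E ∩ S) ≤ M * ∫⁻ x in box a ℓ, g x ∧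
        ∀ x ∈ box a ℓ, x ∉ S → ∃ a', x ∈ box a' (ℓ / 2 ^ k) ∧ SubBox a' (ℓ / 2 ^ k) a₀ ℓ₀ ∧
          ∫⁻ x in box a' (ℓ / 2 ^ k), g x ≤ t * volume (box a' (ℓ / 2 ^ k)) := by
  induction k with
  | zero =>
    intro a ℓ _ hsub hg
    exact ⟨∅, by simp, fun x hx _ => ⟨a, by simpa using hx, by simpa using hsub, by simpa using hg⟩⟩
  | succ k ih =>
    intro a ℓ hℓ hsub hg
    have key : ∀ b : Fin n → Bool, ∃ S,
        t * volume (E ∩ S) ≤ M * ∫⁻ x in box (childCorner a ℓ b) (ℓ / 2), g x ∧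
        ∀ x ∈ box (childCorner a ℓ b) (ℓ / 2), x ∉ S →
          ∃ a', x ∈ box a' (ℓ / 2 ^ (k + 1)) ∧ SubBox a' (ℓ / 2 ^ (k + 1)) a₀ ℓ₀ ∧
          ∫⁻ x in box a' (ℓ / 2 ^ (k + 1)), g x ≤ t * volume (box a' (ℓ / 2 ^ (k + 1))) := by
      intro b
      have hc := subBox_childCorner a hℓ b
      rcases le_or_gt (∫⁻ x in box (childCorner a ℓ b) (ℓ / 2), g x)
        (t * volume (box (childCorner a ℓ b) (ℓ / 2))) with h | h
      · have := ih _ _ (half_pos hℓ) (hc.trans hsub) h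
        rwa [show ℓ / 2 / 2 ^ k = ℓ / 2 ^ (k + 1) by rw [pow_succ', div_div]] at this
      -- A stopped child: its unstopped parent has `2^n` times its volume, which bounds the
      -- overshoot.
      · refine ⟨_, hE _ _ (half_pos hℓ) (hc.trans hsub) h ?_, fun x hx hx' => absurd hx hx'⟩
        calc _ ≤ ∫⁻ x in box a ℓ, g x := lintegral_mono_set hc.subset
          _ ≤ t * volume (box a ℓ) := hg
          _ = _ := by rw [volume_box_eq_mul_child a (childCorner a ℓ b)]; ring
    choose S hS hS' using key
    refine ⟨⋃ b, S b, ?_, fun x hx hxS => ?_⟩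
    · rw [← sum_lintegral_child g a hℓ, Finset.mul_sum, inter_iUnion]
      calc _ ≤ t * ∑ b, volume (E ∩ S b) := by gcongr; exact measure_iUnion_fintype_le _ _
        _ ≤ _ := by rw [Finset.mul_sum]; exact Finset.sum_le_sum fun b _ => hS b
    · rw [← iUnion_child a hℓ] at hx
      obtain ⟨b, hb⟩ := mem_iUnion.1 hx
      exact hS' b x hb fun h => hxS (mem_iUnion.2 ⟨b, h⟩)

/-- A one-sided form of Lebesgue's differentiation theorem along cubes shrinking to a point. -/
theorem ae_enorm_le_of_frequently_lintegral_le {g : (Fin n → ℝ) → ℝ} {a₀ : Fin n → ℝ} {ℓ₀ : ℝ}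
    (hg : IntegrableOn g (box a₀ ℓ₀)) (t : ℝ≥0) {r : ℕ → ℝ} (hr : ∀ k, 0 < r k)
    (hr0 : Tendsto r atTop (𝓝 0)) :
    ∀ᵐ x, x ∈ box a₀ ℓ₀ → (∃ᶠ k in atTop, ∃ a, x ∈ box a (r k) ∧ SubBox a (r k) a₀ ℓ₀ ∧
      ∫⁻ x in box a (r k), ‖g x‖ₑ ≤ t * volume (box a (r k))) → ‖g x‖ₑ ≤ t := by
  have hint : Integrable ((box a₀ ℓ₀).indicator fun x => ‖g x‖) :=
    IntegrableOn.integrable_indicator hg.norm (measurableSet_box _ _)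
  filter_upwards [IsUnifLocDoublingMeasure.ae_tendsto_average volume hint.locallyIntegrable 1]
    with x hx hx0 hfreq
  obtain ⟨ψ, hψ, h⟩ := extraction_of_frequently_atTop hfreq
  choose a hxa hsub hle using h
  have hδ : Tendsto (fun j => r (ψ j) / 2) atTop (𝓝[>] 0) := by
    refine tendsto_nhdsWithin_iff.2 ⟨?_, Eventually.of_forall fun j => half_pos (hr _)⟩
    simpa using (hr0.comp hψ.tendsto_atTop).div_const 2
  -- Cubes are sup-norm balls up to null sets; the centres may vary since `x` stays in the ball
  -- (dilation factor `1`).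
  have hlim := hx (fun j i => a j i + r (ψ j) / 2) _ hδ (Eventually.of_forall fun j => by
    rw [one_mul, closedBall_pi _ (half_pos (hr _)).le]
    intro i hi
    have := hxa j i hi
    simp only [mem_Ico] at this
    change x i ∈ Metric.closedBall (a j i + r (ψ j) / 2) (r (ψ j) / 2)
    rw [Real.closedBall_eq_Icc]
    constructor <;> linarith)
  rw [indicator_of_mem hx0] at hlim
  have : ‖g x‖ ≤ t := by
    refine le_of_tendsto hlim (Eventually.of_forall fun j => ?_)
    have hpos : 0 < volume.real (box (a j) (r (ψ j))) :=
      ENNReal.toReal_pos (volume_box_ne_zero _ (hr _)) (volume_box_ne_top _ _)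
    have hball := box_ae_eq_closedBall (a j) (hr (ψ j))
    rw [setAverage_eq, setIntegral_congr_set hball.symm, measureReal_congr hball.symm,
      setIntegral_congr_fun (measurableSet_box _ _)
        (fun y hy => indicator_of_mem ((hsub j).subset hy) _),
      integral_norm_eq_lintegral_enorm (hg.mono_set (hsub j).subset).aestronglyMeasurable,
      smul_eq_mul, inv_mul_le_iff₀ hpos, mul_comm]
    have := ENNReal.toReal_mono
      (ENNReal.mul_ne_top ENNReal.coe_ne_top (volume_box_ne_top _ _)) (hle j)
    simpa [ENNReal.toReal_mul, Measure.real] using this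
  rw [← ofReal_norm]
  exact ENNReal.ofReal_le_of_le_toReal (by simpa using this)

/-! ### Geometric decay of the oscillation -/

theorem enorm_setAverage_sub_mul_le {α : Type*} [MeasurableSpace α] {μ : Measure α} {f : α → ℝ}
    {s : Set α} (hf : IntegrableOn f s μ) (h0 : μ s ≠ 0) (htop : μ s ≠ ∞) (c : ℝ) :
    ‖(⨍ x in s, f x ∂μ) - c‖ₑ * μ s ≤ ∫⁻ x in s, ‖f x - c‖ₑ ∂μ := by
  have hpos : 0 < μ.real s := ENNReal.toReal_pos h0 htop
  have hc : IntegrableOn (fun _ => c) s μ := integrableOn_const htop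
  have h : ((⨍ x in s, f x ∂μ) - c) * μ.real s = ∫ x in s, (f x - c) ∂μ := by
    rw [integral_sub hf hc, setAverage_eq, setIntegral_const, smul_eq_mul, smul_eq_mul]
    field_simp
  have h' := enorm_integral_le_lintegral_enorm (μ := μ.restrict s) fun x => f x - c
  rw [← h, enorm_mul, Real.enorm_eq_ofReal hpos.le, Measure.real, ENNReal.ofReal_toReal htop] at h'
  exact h'

/-- A good-λ step of the John–Nirenberg inequality, iterated: the distribution function of the
oscillation of `f` decays geometrically on every subcube. -/
theorem volume_oscillation_gt_le {f : (Fin n → ℝ) → ℝ} {B : ℝ≥0} (hB0 : 0 < B)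
    {a₀ : Fin n → ℝ} {ℓ₀ : ℝ} (hf : IntegrableOn f (box a₀ ℓ₀))
    (hB : ∀ a ℓ, 0 < ℓ → SubBox a ℓ a₀ ℓ₀ →
      ∫⁻ x in box a ℓ, ‖f x - ⨍ y in box a ℓ, f y‖ₑ ≤ B * volume (box a ℓ)) (k : ℕ) :
    ∀ a ℓ, 0 < ℓ → SubBox a ℓ a₀ ℓ₀ →
      volume ({x | k * (2 ^ n * (2 * B) : ℝ≥0∞) < ‖f x - ⨍ y in box a ℓ, f y‖ₑ} ∩ box a ℓ) ≤
        2⁻¹ ^ k * volume (box a ℓ) := by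
  induction k with
  | zero => intro a ℓ _ _; simpa using measure_mono inter_subset_right
  | succ k ih =>
    intro a ℓ hℓ hsub
    set m := ⨍ y in box a ℓ, f y with hm
    set E := {x | ((k + 1 : ℕ) : ℝ≥0∞) * (2 ^ n * (2 * B)) < ‖f x - m‖ₑ} with hEdef
    have hfa : IntegrableOn f (box a ℓ) := hf.mono_set hsub.subset
    have hgood := hB a ℓ hℓ hsub
    have ht : (2 * B : ℝ≥0∞) ≠ 0 := by simpa using hB0.ne'
    have ht' : (2 * B : ℝ≥0∞) ≠ ∞ := by finiteness
    have hfamily := exists_stopping_set (g := fun x => ‖f x - m‖ₑ) (E := E) (t := 2 * B)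
      (M := 2⁻¹ ^ k) (a₀ := a) (ℓ₀ := ℓ) (by
        intro a' ℓ' hℓ' hs' hlow hup
        have hfa' := hfa.mono_set hs'.subset
        have hv0 := volume_box_ne_zero a' hℓ'
        have hvt := volume_box_ne_top a' ℓ'
        have hd : ‖(⨍ y in box a' ℓ', f y) - m‖ₑ ≤ 2 ^ n * (2 * B) :=
          (ENNReal.mul_le_mul_iff_left hv0 hvt).1
            ((enorm_setAverage_sub_mul_le hfa' hv0 hvt m).trans hup)
        -- Recentring at the mean of the stopped cube costs one level, by `hd`.
        have hsubset : E ∩ box a' ℓ' ⊆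
            {x | k * (2 ^ n * (2 * B) : ℝ≥0∞) < ‖f x - ⨍ y in box a' ℓ', f y‖ₑ} ∩ box a' ℓ' := by
          refine inter_subset_inter_left _ fun x hx => ?_
          by_contra hcon
          rw [mem_ofPred_eq, not_lt] at hcon
          refine absurd (mem_ofPred_eq ▸ hx : _ < _) (not_lt.2 ?_)
          calc ‖f x - m‖ₑ = ‖(f x - ⨍ y in box a' ℓ', f y) + ((⨍ y in box a' ℓ', f y) - m)‖ₑ := by
                rw [sub_add_sub_cancel]
            _ ≤ _ := enorm_add_le _ _
            _ ≤ k * (2 ^ n * (2 * B)) + 2 ^ n * (2 * B) := add_le_add hcon hd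
            _ = _ := by push_cast; ring
        calc 2 * B * volume (E ∩ box a' ℓ') ≤ 2 * B * (2⁻¹ ^ k * volume (box a' ℓ')) := by
              gcongr
              exact (measure_mono hsubset).trans (ih a' ℓ' hℓ' (hs'.trans hsub))
          _ = 2⁻¹ ^ k * (2 * B * volume (box a' ℓ')) := by ring
          _ ≤ _ := by gcongr)
    have hgood' : ∫⁻ x in box a ℓ, ‖f x - m‖ₑ ≤ 2 * B * volume (box a ℓ) := by
      refine hgood.trans ?_
      gcongr
      exact le_mul_of_one_le_left zero_le one_le_two
    choose S hS hS' using fun j => hfamily j a ℓ hℓ (SubBox.refl a ℓ) hgood'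
    have hleb := ae_enorm_le_of_frequently_lintegral_le (g := fun x => f x - m)
      (hfa.sub (integrableOn_const (volume_box_ne_top a ℓ))) (2 * B)
      (r := fun j => ℓ / 2 ^ j) (fun j => by positivity)
      (tendsto_const_nhds.div_atTop (tendsto_pow_atTop_atTop_of_one_lt one_lt_two))
    push_cast at hleb
    -- The sets `S j` need not be nested. A point of `E` outside infinitely many of them would
    -- satisfy `|f - m| ≤ 2B` a.e., so almost every point of `E` is eventually in all `S j`.
    have hcover : (E ∩ box a ℓ : Set _) ≤ᵐ[volume] ⋃ K : ℕ, E ∩ ⋂ j ≥ K, S j := by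
      filter_upwards [hleb] with x hx hxE
      obtain ⟨hxE, hxQ⟩ := hxE
      change x ∈ ⋃ K : ℕ, E ∩ ⋂ j ≥ K, S j
      by_contra hcon
      simp only [mem_iUnion, mem_inter_iff, hxE, true_and, mem_iInter, not_exists, not_forall]
        at hcon
      have hle := hx hxQ (frequently_atTop.2 fun K => by
        obtain ⟨j, hj, hxj⟩ := hcon K
        exact ⟨j, hj, hS' j x hxQ hxj⟩)
      refine absurd (show _ < _ from hxE) (not_lt.2 (hle.trans ?_))
      calc (2 * B : ℝ≥0∞) = 1 * (1 * (2 * B)) := by ring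
        _ ≤ _ := by
          gcongr
          · exact_mod_cast Nat.succ_pos k
          · exact one_le_pow₀ one_le_two
    have hmono : Monotone fun K : ℕ => E ∩ ⋂ j ≥ K, S j := fun K L hKL =>
      inter_subset_inter_right _ (biInter_subset_biInter_left fun j hj => le_trans hKL hj)
    have hbound : 2 * B * volume (E ∩ box a ℓ) ≤ 2⁻¹ ^ k * (B * volume (box a ℓ)) := by
      refine (mul_le_mul_right (measure_mono_ae hcover) _).trans ?_
      rw [hmono.measure_iUnion, ENNReal.mul_iSup]
      refine iSup_le fun K => ?_
      calc _ ≤ 2 * B * volume (E ∩ S K) := by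
            gcongr
            exact biInter_subset_of_mem (le_refl K)
        _ ≤ _ := (hS K).trans (by gcongr)
    -- Level `2B` against mean oscillation `B` yields the extra factor `1/2`.
    refine (ENNReal.mul_le_mul_iff_right ht ht').1 (hbound.trans_eq ?_)
    rw [pow_succ]
    calc _ = 2⁻¹ ^ k * (1 * B * volume (box a ℓ)) := by ring
      _ = 2⁻¹ ^ k * (2⁻¹ * 2 * B * volume (box a ℓ)) := by
        rw [ENNReal.inv_mul_cancel two_ne_zero ENNReal.ofNat_ne_top]
      _ = _ := by ring

/-! ### From distribution functions to `L^q` bounds -/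

/-- The constant `∑ₖ (k+1)^q 2⁻ᵏ`. -/
def decaySum (q : ℝ) : ℝ≥0∞ := ∑' k : ℕ, ((k : ℝ≥0∞) + 1) ^ q * 2⁻¹ ^ k

theorem decaySum_ne_top (q : ℝ) : decaySum q ≠ ∞ := by
  obtain ⟨m, hm⟩ := exists_nat_ge q
  have hs : Summable fun k : ℕ => ((k + 1 : ℕ) : ℝ≥0) ^ m * 2⁻¹ ^ (k + 1) := by
    rw [← NNReal.summable_coe]
    push_cast
    have := (summable_nat_add_iff 1).2 (summable_pow_mul_geometric_of_norm_lt_one (R := ℝ) m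
      (r := 2⁻¹) (by norm_num))
    simpa using this
  have hs' : Summable fun k : ℕ => 2 * (((k + 1 : ℕ) : ℝ≥0) ^ m * 2⁻¹ ^ (k + 1)) := hs.mul_left 2
  refine ne_top_of_le_ne_top (ENNReal.tsum_coe_ne_top_iff_summable.2 hs') ?_
  refine ENNReal.tsum_le_tsum fun k => ?_
  have h1 : ((k : ℝ≥0∞) + 1) ^ q ≤ (k + 1) ^ m := by
    rw [← ENNReal.rpow_natCast]
    exact ENNReal.rpow_le_rpow_of_exponent_le (by simp) hm
  calc _ ≤ ((k : ℝ≥0∞) + 1) ^ m * 2⁻¹ ^ k := by gcongr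
    _ = (2 * 2⁻¹) * (((k : ℝ≥0∞) + 1) ^ m * 2⁻¹ ^ k) := by
      rw [ENNReal.mul_inv_cancel two_ne_zero ENNReal.ofNat_ne_top, one_mul]
    _ = _ := by push_cast [ENNReal.coe_inv (two_ne_zero)]; ring

/-- Integrating a geometrically decaying distribution function. -/
theorem lintegral_rpow_le_of_measure_gt_le {α : Type*} [MeasurableSpace α] {μ : Measure α}
    {h : α → ℝ≥0∞} (hm : AEMeasurable h μ) (hfin : ∀ x, h x ≠ ∞) {q : ℝ} (hq : 0 < q)
    {C A : ℝ≥0∞} (hC : C ≠ 0) (hC' : C ≠ ∞)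
    (hdecay : ∀ k : ℕ, μ {x | k * C < h x} ≤ 2⁻¹ ^ k * A) :
    ∫⁻ x, h x ^ q ∂μ ≤ decaySum q * C ^ q * A := by
  have hms : ∀ k : ℕ, NullMeasurableSet {x | k * C < h x} μ := fun k =>
    nullMeasurableSet_lt aemeasurable_const hm
  -- Where `h x ≠ 0`, the single term with `kC < h x ≤ (k+1)C` already dominates.
  have hpt : ∀ x, h x ^ q ≤
      ∑' k : ℕ, {x | k * C < h x}.indicator (fun _ => (((k : ℝ≥0∞) + 1) * C) ^ q) x := by
    intro x
    rcases eq_or_ne (h x) 0 with h0 | h0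
    · simp [h0, hq]
    have hex : ∃ j : ℕ, h x ≤ j * C := by
      obtain ⟨j, hj⟩ := ENNReal.exists_nat_gt (ENNReal.div_ne_top (hfin x) hC)
      exact ⟨j, (ENNReal.div_le_iff hC hC').1 hj.le⟩
    classical
    obtain ⟨k, hk⟩ : ∃ k, Nat.find hex = k + 1 := by
      refine Nat.exists_eq_succ_of_ne_zero fun hz => h0 ?_
      have := Nat.find_spec hex
      rw [hz] at this
      simpa using this
    have hk1 : h x ≤ ((k : ℝ≥0∞) + 1) * C := by
      have := Nat.find_spec hex
      rw [hk] at this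
      simpa using this
    have hk2 : k * C < h x := not_le.1 (Nat.find_min hex (by omega))
    refine le_trans ?_ (ENNReal.le_tsum k)
    rw [indicator_of_mem (show x ∈ {x | k * C < h x} from hk2)]
    exact ENNReal.rpow_le_rpow hk1 hq.le
  calc ∫⁻ x, h x ^ q ∂μ ≤ _ := lintegral_mono hpt
    _ = ∑' k : ℕ, (((k : ℝ≥0∞) + 1) * C) ^ q * μ {x | k * C < h x} := by
      rw [lintegral_tsum fun k => aemeasurable_const.indicator₀ (hms k)]
      exact tsum_congr fun k => lintegral_indicator_const₀ (hms k) _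
    _ ≤ ∑' k : ℕ, ((k : ℝ≥0∞) + 1) ^ q * 2⁻¹ ^ k * (C ^ q * A) := by
      refine ENNReal.tsum_le_tsum fun k => ?_
      rw [ENNReal.mul_rpow_of_nonneg _ _ hq.le]
      calc _ ≤ ((k : ℝ≥0∞) + 1) ^ q * C ^ q * (2⁻¹ ^ k * A) := by gcongr; exact hdecay k
        _ = _ := by ring
    _ = _ := by rw [ENNReal.tsum_mul_right, decaySum, mul_assoc]

/-- The `L^q` form of the John–Nirenberg inequality on a half-open cube. -/
theorem lintegral_box_oscillation_rpow_le {f : (Fin n → ℝ) → ℝ} {B : ℝ≥0} (hB0 : 0 < B)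
    {q : ℝ} (hq : 0 < q) {a : Fin n → ℝ} {ℓ : ℝ} (hℓ : 0 < ℓ) (hf : IntegrableOn f (box a ℓ))
    (hB : ∀ a' ℓ', 0 < ℓ' → SubBox a' ℓ' a ℓ →
      ∫⁻ x in box a' ℓ', ‖f x - ⨍ y in box a' ℓ', f y‖ₑ ≤ B * volume (box a' ℓ')) :
    ∫⁻ x in box a ℓ, ‖f x - ⨍ y in box a ℓ, f y‖ₑ ^ q ≤
      decaySum q * (2 ^ n * (2 * B)) ^ q * volume (box a ℓ) := by
  refine lintegral_rpow_le_of_measure_gt_le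
    (hf.aestronglyMeasurable.sub aestronglyMeasurable_const).enorm (fun x => enorm_ne_top) hq
    (mul_ne_zero (by simp) (by simpa using hB0.ne')) (by finiteness) fun k => ?_
  rw [Measure.restrict_apply' (measurableSet_box a ℓ)]
  exact volume_oscillation_gt_le hB0 hf hB k a ℓ hℓ (SubBox.refl a ℓ)

/-! ### Transfer to open cubes in Euclidean space -/

theorem box_ae_eq_preimage_openCube (a : EuclideanSpace ℝ (Fin n)) (ℓ : ℝ) :
    box a.ofLp ℓ =ᵐ[volume] WithLp.toLp 2 ⁻¹' openCube a ℓ := by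
  have : (WithLp.toLp 2 ⁻¹' openCube a ℓ : Set (Fin n → ℝ)) =
      univ.pi fun i => Ioo (a i) (a i + ℓ) := by
    ext x; simp [openCube]
  rw [this]
  exact Measure.univ_pi_Ico_ae_eq_Icc.trans Measure.univ_pi_Ioo_ae_eq_Icc.symm

theorem measurableEmbedding_toLp :
    MeasurableEmbedding (WithLp.toLp 2 : (Fin n → ℝ) → EuclideanSpace ℝ (Fin n)) :=
  (MeasurableEquiv.toLp 2 (Fin n → ℝ)).measurableEmbedding

theorem setLIntegral_box (a : EuclideanSpace ℝ (Fin n)) (ℓ : ℝ)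
    (g : EuclideanSpace ℝ (Fin n) → ℝ≥0∞) :
    ∫⁻ x in box a.ofLp ℓ, g (WithLp.toLp 2 x) = ∫⁻ x in openCube a ℓ, g x := by
  rw [setLIntegral_congr (box_ae_eq_preimage_openCube a ℓ)]
  exact (PiLp.volume_preserving_toLp (Fin n)).setLIntegral_comp_preimage_emb
    measurableEmbedding_toLp _ _

theorem volume_box_eq_openCube (a : EuclideanSpace ℝ (Fin n)) (ℓ : ℝ) :
    volume (box a.ofLp ℓ) = volume (openCube a ℓ) := by
  simpa using setLIntegral_box a ℓ fun _ => 1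

theorem setAverage_box (a : EuclideanSpace ℝ (Fin n)) (ℓ : ℝ)
    (f : EuclideanSpace ℝ (Fin n) → ℝ) :
    ⨍ x in box a.ofLp ℓ, f (WithLp.toLp 2 x) = ⨍ x in openCube a ℓ, f x := by
  rw [setAverage_eq, setAverage_eq, Measure.real, volume_box_eq_openCube, Measure.real,
    setIntegral_congr_set (box_ae_eq_preimage_openCube a ℓ),
    (PiLp.volume_preserving_toLp (Fin n)).setIntegral_preimage_emb measurableEmbedding_toLp]

theorem integrableOn_box {a : EuclideanSpace ℝ (Fin n)} {ℓ : ℝ}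
    {f : EuclideanSpace ℝ (Fin n) → ℝ} (hf : IntegrableOn f (openCube a ℓ)) :
    IntegrableOn (fun x => f (WithLp.toLp 2 x)) (box a.ofLp ℓ) :=
  (((PiLp.volume_preserving_toLp (Fin n)).integrableOn_comp_preimage
    measurableEmbedding_toLp).2 hf).congr_set_ae (box_ae_eq_preimage_openCube a ℓ)

theorem openCube_subset_of_subBox {a b : EuclideanSpace ℝ (Fin n)} {r s : ℝ}
    (h : SubBox a.ofLp r b.ofLp s) : openCube a r ⊆ openCube b s :=
  fun _ hx i => ⟨(h i).1.trans_lt (hx i).1, (hx i).2.trans_le (h i).2⟩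

theorem LocallyIntegrableOn.integrableOn_of_compactlyContained
    {V U : Set (EuclideanSpace ℝ (Fin n))} {φ : EuclideanSpace ℝ (Fin n) → ℝ}
    (hφ : LocallyIntegrableOn φ V) (h : CompactlyContained U V) : IntegrableOn φ U := by
  obtain ⟨K, hK, hUK, hKV⟩ := h
  exact (hφ.integrableOn_compact_subset hKV hK).mono_set hUK

/-- The John–Nirenberg inequality for the averaged `L^q` oscillation on a cube `Q ⋐ V`. -/
theorem laverage_oscillation_rpow_le {V : Set (EuclideanSpace ℝ (Fin n))}
    {φ : EuclideanSpace ℝ (Fin n) → ℝ} (hφ : LocallyIntegrableOn φ V) {B : ℝ≥0} (hB0 : 0 < B)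
    (hB : bmoSeminorm V φ ≤ B) {q : ℝ} (hq : 0 < q) {Q : Set (EuclideanSpace ℝ (Fin n))}
    (hQ : IsCube Q) (hQV : CompactlyContained Q V) :
    ⨍⁻ x in Q, ‖φ x - ⨍ y in Q, φ y‖ₑ ^ q ∂volume ≤ decaySum q * (2 ^ n * (2 * B)) ^ q := by
  obtain ⟨a, ℓ, hℓ, rfl⟩ := hQ
  have hv0 := volume_box_ne_zero a.ofLp hℓ
  have hvt := volume_box_ne_top a.ofLp ℓ
  have key := lintegral_box_oscillation_rpow_le (f := fun x => φ (WithLp.toLp 2 x)) hB0 hq hℓ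
    (integrableOn_box (LocallyIntegrableOn.integrableOn_of_compactlyContained hφ hQV)) (by
      intro a' ℓ' hℓ' hsub
      have hv0' := volume_box_ne_zero a' hℓ'
      have hvt' := volume_box_ne_top a' ℓ'
      have hosc : ⨍⁻ x in openCube (WithLp.toLp 2 a') ℓ',
          ‖φ x - ⨍ y in openCube (WithLp.toLp 2 a') ℓ', φ y‖ₑ ∂volume ≤ B := by
        refine le_trans (le_iSup₂_of_le _ ⟨⟨_, ℓ', hℓ', rfl⟩, ?_⟩ le_rfl) hB
        obtain ⟨K, hK, hUK, hKV⟩ := hQV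
        exact ⟨K, hK, (openCube_subset_of_subBox hsub).trans hUK, hKV⟩
      have e1 := setAverage_box (WithLp.toLp 2 a') ℓ' φ
      have e2 := volume_box_eq_openCube (WithLp.toLp 2 a') ℓ'
      have e3 := setLIntegral_box (WithLp.toLp 2 a') ℓ'
        fun x => ‖φ x - ⨍ y in openCube (WithLp.toLp 2 a') ℓ', φ y‖ₑ
      simp only at e1 e2 e3
      rw [setLAverage_eq, ← e2, ← e3, ENNReal.div_le_iff hv0' hvt'] at hosc
      rwa [e1])
  rw [setAverage_box, volume_box_eq_openCube,
    setLIntegral_box a ℓ fun x => ‖φ x - ⨍ y in openCube a ℓ, φ y‖ₑ ^ q] at key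
  rw [volume_box_eq_openCube] at hv0 hvt
  rwa [setLAverage_eq, ENNReal.div_le_iff hv0 hvt]

/-! ### The two inequalities -/

theorem bmoSeminormLq_le_mul {V : Set (EuclideanSpace ℝ (Fin n))}
    {φ : EuclideanSpace ℝ (Fin n) → ℝ} (hφ : MemBMO V φ) {q : ℝ} (hq : 0 < q) {N : ℝ≥0∞}
    (hN0 : N ≠ 0) (hN : N ≠ ∞) (hle : decaySum q ^ (1 / q) * 2 ^ n * 2 ≤ N) :
    bmoSeminormLq q V φ ≤ N * bmoSeminorm V φ := by
  rw [mul_comm, ← ENNReal.div_le_iff hN0 hN]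
  -- Any `B` strictly above the seminorm is positive, which covers a vanishing seminorm too.
  refine le_of_forall_gt_imp_ge_of_dense fun B hB => ?_
  rcases eq_or_ne B ∞ with rfl | hBt
  · exact le_top
  lift B to ℝ≥0 using hBt
  rw [ENNReal.div_le_iff hN0 hN]
  refine iSup₂_le fun Q hQ => ?_
  have hB0 : 0 < B := by exact_mod_cast lt_of_le_of_lt zero_le hB
  have hq' : 0 ≤ 1 / q := by positivity
  calc _ ≤ (decaySum q * (2 ^ n * (2 * B)) ^ q) ^ (1 / q) :=
        ENNReal.rpow_le_rpow (laverage_oscillation_rpow_le hφ.1 hB0 hB.le hq hQ.1 hQ.2) hq'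
    _ = B * (decaySum q ^ (1 / q) * 2 ^ n * 2) := by
      rw [ENNReal.mul_rpow_of_nonneg _ _ hq', ← ENNReal.rpow_mul, mul_one_div_cancel hq.ne',
        ENNReal.rpow_one]
      ring
    _ ≤ B * N := by gcongr

theorem bmoSeminorm_le_bmoSeminormLq {V : Set (EuclideanSpace ℝ (Fin n))}
    {φ : EuclideanSpace ℝ (Fin n) → ℝ} (hφ : LocallyIntegrableOn φ V) {q : ℝ} (hq : 1 ≤ q) :
    bmoSeminorm V φ ≤ bmoSeminormLq q V φ := by
  refine iSup₂_mono fun Q hQ => ?_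
  obtain ⟨⟨a, ℓ, hℓ, rfl⟩, hQV⟩ := hQ
  have hv0 := volume_box_ne_zero a.ofLp hℓ
  have hvt := volume_box_ne_top a.ofLp ℓ
  rw [volume_box_eq_openCube] at hv0 hvt
  have hint := LocallyIntegrableOn.integrableOn_of_compactlyContained hφ hQV
  have : NeZero (volume.restrict (openCube a ℓ)) :=
    ⟨fun h => hv0 (Measure.restrict_eq_zero.1 h)⟩
  have : IsFiniteMeasure (volume.restrict (openCube a ℓ)) := ⟨by simpa using hvt.lt_top⟩
  have hmeas : AEStronglyMeasurable (fun x => φ x - ⨍ y in openCube a ℓ, φ y)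
      ((volume.restrict (openCube a ℓ) univ)⁻¹ • volume.restrict (openCube a ℓ)) :=
    (hint.aestronglyMeasurable.sub aestronglyMeasurable_const).smul_measure _
  have hq0 : 0 < q := one_pos.trans_le hq
  have h := eLpNorm_le_eLpNorm_of_exponent_le (p := 1) (q := ENNReal.ofReal q)
    (by simpa using hq) hmeas
  rwa [eLpNorm_one_eq_lintegral_enorm, eLpNorm_eq_lintegral_rpow_enorm_toReal (by simpa using hq0)
    ENNReal.ofReal_ne_top, ENNReal.toReal_ofReal hq0.le] at h

end BMOSpace

end

theorem corollary2p6 (n : ℕ) (hn : 2 ≤ n) (q : ℝ) (hq : 1 < q) :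
    ∃ N : ℝ≥0, ∀ V : Set (EuclideanSpace ℝ (Fin n)), BMOSpace.IsBoundedDomain V →
      ∀ φ : EuclideanSpace ℝ (Fin n) → ℝ, BMOSpace.MemBMO V φ →
        BMOSpace.bmoSeminorm V φ ≤ BMOSpace.bmoSeminormLq q V φ ∧
          BMOSpace.bmoSeminormLq q V φ ≤ (N : ℝ≥0∞) * BMOSpace.bmoSeminorm V φ := by
  have hq0 : 0 < q := one_pos.trans hq
  -- The `+ 1` makes the constant visibly nonzero, as the division by `N` requires.
  have hfin : BMOSpace.decaySum q ^ (1 / q) * 2 ^ n * 2 + 1 ≠ ∞ := by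
    have := ENNReal.rpow_ne_top_of_nonneg (y := 1 / q) (by positivity)
      (BMOSpace.decaySum_ne_top q)
    finiteness
  refine ⟨(BMOSpace.decaySum q ^ (1 / q) * 2 ^ n * 2 + 1).toNNReal, fun V _ φ hφ =>
    ⟨BMOSpace.bmoSeminorm_le_bmoSeminormLq hφ.1 hq.le, ?_⟩⟩
  rw [ENNReal.coe_toNNReal hfin]
  exact BMOSpace.bmoSeminormLq_le_mul hφ hq0 (by simp) hfin le_self_add
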